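/- **Theorem 4.10 (Construction-Selection).** Let $n,q\ge 1$, let $\mathbf d=(d_1,\dots,d_q)$ with all $d_i\ge 1$, and let $f=(f_1,\dots,f_q)$, where $f_i\in\mathbb R[X_0,\dots,X_n]$ is homogeneous of degree $d_i$. Write $\mathbf D:=\max_i d_i$, $\Delta:=\operatorname{diag}(d_1,\dots,d_q)$, $\mathbb S^n$ for the Euclidean unit sphere of $\mathbb R^{n+1}$, $\|\cdot\|$ for the Euclidean norm, and $$\|f\|_\infty:=\max_{x\in\mathbb S^n}\max_i|f_i(x)|,\qquad \mathcal Z_{\mathbb S}(f):=\{x\in\mathbb S^n\mid f(x)=0\}.$$ For $x\in\mathbb S^n$ let $D_xf:T_x\mathbb S^n=x^\perp\to\mathbb R^q$ be the restriction to $x^\perp$ of the derivative of $f$ at $x$, let $A^\dagger:=A^*(AA^*)^{-1}$ be the Moore-Penrose inverse of a surjective linear map $A$, and set $$\mathsf K(f,x):=\frac{\sqrt q\,\|f\|_\infty}{\max\{\|f(x)\|,\ \|D_xf^\dagger\Delta\|^{-1}\}},\qquad \mathsf K(f):=\sup_{x\in\mathbb S^n}\mathsf K(f,x)\in[0,\infty],$$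 where the operator norm is taken with respect to Euclidean norms, $\|D_xf^\dagger\Delta\|^{-1}:=0$ if $D_xf$ is not surjective, and $\mathsf K(f,x):=\infty$ if the denominator is $0$ (in particular $\mathsf K(0)=\infty$). Let $\delta\in\mathbb R$ and let $\mathcal G\subseteq\mathbb S^n$ be a $\delta$-net, i.e. a finite set such that every point of $\mathbb S^n$ has geodesic distance less than $\delta$ to some point of $\mathcal G$. If $$4\,\mathbf D^2\,\mathsf K(f)^2\,\delta<1$$ and $Q\in\mathbb R$ satisfies $0.99\,Q\le\|f\|_\infty\le Q$, then $$\operatorname{dist}_H\!\left(\left\{x\in\mathcal G\ \middle|\ \frac{\|f(x)\|}{\sqrt q\,Q}<\mathbf D\,\delta\right\},\ \mathcal Z_{\mathbb S}(f)\right)<2\,\mathbf D\,\mathsf K(f)\,\delta,$$ where $\operatorname{dist}_H(A,B):=\max\{\sup_{a\in A}\operatorname{dist}(a,B),\ \sup_{b\in B}\operatorname{dist}(b,A)\}\in[0,\infty]$ is the Hausdorff distance for the Euclidean distance, with $\operatorname{dist}(\cdot,\emptyset)=\infty$ and $\sup\emptyset=0$ (so one of the two sets is empty only if both are). -/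

import Mathlib

open scoped ENNReal

noncomputable section

namespace GridK

/-- The Euclidean space `ℝ^m`. -/
abbrev Euc (m : ℕ) : Type := EuclideanSpace ℝ (Fin m)

/-- The unit sphere `𝕊ⁿ ⊆ ℝⁿ⁺¹`. -/
abbrev sph (n : ℕ) : Set (Euc (n + 1)) := Metric.sphere 0 1

/-- `q`-tuples `f = (f₁, …, f_q)` of real polynomials in `X₀, …, Xₙ`. -/
abbrev PolySystem (n q : ℕ) : Type := Fin q → MvPolynomial (Fin (n + 1)) ℝ

/-- `f` belongs to `𝓗_𝐝[q]`: the `i`-th polynomial is homogeneous of degree `dᵢ`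
(the zero polynomial is homogeneous of every degree). -/
def IsHomSystem {n q : ℕ} (d : Fin q → ℕ) (f : PolySystem n q) : Prop :=
  ∀ i, (f i).IsHomogeneous (d i)

/-- `𝐃 = max {d₁, …, d_q}`. -/
def maxDegree {q : ℕ} (d : Fin q → ℕ) : ℕ := Finset.univ.sup d

/-- The value `f(x) ∈ ℝ^q`; its norm is the Euclidean one. -/
def evalSys {n q : ℕ} (f : PolySystem n q) (x : Euc (n + 1)) : Euc q :=
  WithLp.toLp 2 fun i => MvPolynomial.eval x.ofLp (f i)

/-- `‖f‖_∞ = max_{x ∈ 𝕊ⁿ} max_i |fᵢ(x)|`; the norm on `Fin q → ℝ` is the maximum norm. -/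
def supNorm {n q : ℕ} (f : PolySystem n q) : ℝ :=
  ⨆ x : sph n, ‖fun i => MvPolynomial.eval x.1.ofLp (f i)‖

/-- The tangent space `T_x 𝕊ⁿ = x^⊥`. -/
abbrev tangent {n : ℕ} (x : Euc (n + 1)) : Submodule ℝ (Euc (n + 1)) := (ℝ ∙ x)ᗮ

/-- `D_x f : T_x 𝕊ⁿ → ℝ^q`, the derivative of `f` at `x` restricted to the tangent space. -/
def tangentDeriv {n q : ℕ} (f : PolySystem n q) (x : Euc (n + 1)) : tangent x →L[ℝ] Euc q :=
  (fderiv ℝ (evalSys f) x).comp (tangent x).subtypeL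

/-- The Moore-Penrose inverse `A† = A* (A A*)⁻¹` of a surjective linear map `A`
(only used when `A` is surjective). -/
def pinv {V W : Type*} [NormedAddCommGroup V] [InnerProductSpace ℝ V] [CompleteSpace V]
    [NormedAddCommGroup W] [InnerProductSpace ℝ W] [CompleteSpace W]
    (A : V →L[ℝ] W) : W →L[ℝ] V :=
  (ContinuousLinearMap.adjoint A).comp (A.comp (ContinuousLinearMap.adjoint A)).inverse

/-- The diagonal map `Δ = diag(d₁, …, d_q)` on `ℝ^q`. -/
def degDiag {q : ℕ} (d : Fin q → ℕ) : Euc q →L[ℝ] Euc q :=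
  Matrix.toEuclideanCLM (n := Fin q) (𝕜 := ℝ) (Matrix.diagonal fun i => (d i : ℝ))

open Classical in
/-- `‖D_x f† Δ‖_{2,2}⁻¹`, where `‖D_x f† Δ‖_{2,2} = ∞` (so that the value is `0`)
when `D_x f` is not surjective. -/
def invNormPinv {n q : ℕ} (d : Fin q → ℕ) (f : PolySystem n q) (x : Euc (n + 1)) : ℝ :=
  if Function.Surjective (tangentDeriv f x) then
    ‖(pinv (tangentDeriv f x)).comp (degDiag d)‖⁻¹
  else 0

open Classical in
/-- The real local condition number
`K(f, x) = √q ‖f‖_∞ / max {‖f(x)‖, ‖D_x f† Δ‖⁻¹}`, which is `∞` at a singular zero `x` of `f`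
(that is, when the denominator vanishes). -/
def localK {n q : ℕ} (d : Fin q → ℕ) (f : PolySystem n q) (x : Euc (n + 1)) : ℝ≥0∞ :=
  if max ‖evalSys f x‖ (invNormPinv d f x) = 0 then ⊤
  else ENNReal.ofReal (√(q : ℝ) * supNorm f / max ‖evalSys f x‖ (invNormPinv d f x))

/-- The real global condition number `K(f) = sup_{y ∈ 𝕊ⁿ} K(f, y) ∈ [0, ∞]`. -/
def globalK {n q : ℕ} (d : Fin q → ℕ) (f : PolySystem n q) : ℝ≥0∞ :=
  ⨆ y : sph n, localK d f y.1

/-- A spherical `δ`-net: a finite `G ⊆ 𝕊ⁿ` such that every point of `𝕊ⁿ` has geodesic distance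
(the angle between unit vectors) less than `δ` to `G`. -/
def IsNet {n : ℕ} (δ : ℝ) (G : Finset (Euc (n + 1))) : Prop :=
  (G : Set (Euc (n + 1))) ⊆ sph n ∧
    ∀ x ∈ sph n, ∃ y ∈ G, InnerProductGeometry.angle x y < δ

/-- The zero set of `f` on the sphere. -/
def zeroSet {n q : ℕ} (f : PolySystem n q) : Set (Euc (n + 1)) :=
  {x | x ∈ sph n ∧ evalSys f x = 0}

/-- The selected grid points: `x ∈ G` with `‖f(x)‖ / (√q Q) < 𝐃 δ`. -/
def selected {n q : ℕ} (d : Fin q → ℕ) (f : PolySystem n q) (G : Finset (Euc (n + 1)))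
    (Q δ : ℝ) : Set (Euc (n + 1)) :=
  {x | x ∈ G ∧ ‖evalSys f x‖ / (√(q : ℝ) * Q) < maxDegree d * δ}

end GridK

end

/-! Two facts drive the proof: a Bernstein inequality on the sphere and a variational search for a
zero.

Bernstein: `|D_x f_i v| ≤ d_i ‖f‖_∞` for unit tangent `v`. On a great circle, `exp (i d t) f_i` is a
complex polynomial of degree at most `d = d_i` in `z = exp (2 i t)`, so this reduces to bounding `2
P'(1) - d P(1)` for `P` bounded on the unit circle. It shows that `f` is Lipschitz along great
circles, which makes the grid points near a zero selected, and that `‖D_x f† Δ‖⁻¹ ≤ ‖f‖_∞`, hence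
`K(f) ≥ 1`.

Conversely, put `s = √q ‖f‖_∞ / K(f)`. At every point of the sphere `‖f‖` or `‖D f† Δ‖⁻¹` is at
least `s`. A selected `x` has `‖f(x)‖ < s`, so the second holds on its whole sublevel set, and at
every nonzero of `f` there the Newton direction lowers `‖f‖` at rate at least `s`. For `0 < c < s` a
minimiser of `‖f(z)‖ + c ‖z - x‖` on the sphere must therefore be a zero, within `‖f(x)‖ / c` of
`x`. No second derivative or convergence of Newton's iteration is needed. -/

/-! ### Bernstein's inequality for complex polynomials -/

open Polynomial in
/-- Reflecting a polynomial at degree `d` preserves the bound on the unit circle, so the maximum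
principle bounds `P` by `M ‖z‖ ^ d` outside of the unit disc. -/
theorem Polynomial.norm_eval_le_mul_norm_pow {P : ℂ[X]} {d : ℕ} {M : ℝ} (hP : P.natDegree ≤ d)
    (hM : ∀ z : ℂ, ‖z‖ = 1 → ‖P.eval z‖ ≤ M) :
    ‖P.coeff d‖ ≤ M ∧ ∀ z : ℂ, 1 ≤ ‖z‖ → ‖P.eval z‖ ≤ M * ‖z‖ ^ d := by
  have key : ∀ z : ℂ, z ≠ 0 → (P.reflect d).eval z⁻¹ * z ^ d = P.eval z := by
    intro z hz
    let _ := invertibleOfNonzero hz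
    simpa [eval₂_id] using eval₂_reflect_mul_pow (RingHom.id ℂ) z d P hP
  have hR : ∀ w : ℂ, ‖w‖ ≤ 1 → ‖(P.reflect d).eval w‖ ≤ M := by
    intro w hw
    refine Complex.norm_le_of_forall_mem_frontier_norm_le (f := fun w => (P.reflect d).eval w)
      (Metric.isBounded_ball (x := (0 : ℂ)) (r := 1))
      (Polynomial.differentiable _).diffContOnCl ?_ (z := w) ?_
    · intro z hz
      rw [frontier_ball _ one_ne_zero, mem_sphere_zero_iff_norm] at hz
      have hz0 : z ≠ 0 := by rintro rfl; simp at hz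
      have h := key z⁻¹ (inv_ne_zero hz0)
      rw [inv_inv] at h
      have h2 := hM z⁻¹ (by simp [hz])
      rw [← h] at h2
      simpa [hz] using h2
    · rw [closure_ball _ one_ne_zero]
      simpa using hw
  constructor
  -- The coefficient of degree `d` is the value of the reflected polynomial at `0`.
  · have := hR 0 (by simp)
    rwa [← coeff_zero_eq_eval_zero, coeff_reflect, revAt_le (Nat.zero_le d), Nat.sub_zero] at this
  · intro z hz
    have hz0 : z ≠ 0 := by rintro rfl; simp at hz; linarith
    rw [← key z hz0, norm_mul, norm_pow]
    gcongr
    exact hR _ (by rw [norm_inv]; exact inv_le_one_of_one_le₀ hz)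

/-- `Re (1 / (1 - z)) > 1 / 2` for `z` in the open unit disc. -/
theorem Complex.half_lt_re_one_div_one_sub {z : ℂ} (hz : ‖z‖ < 1) : 1 / 2 < (1 / (1 - z)).re := by
  have h1 : normSq z < 1 := by
    rw [normSq_eq_norm_sq]; nlinarith [norm_nonneg z]
  have hne : 1 - z ≠ 0 := by
    intro h
    rw [sub_eq_zero] at h
    rw [← h] at hz
    simp at hz
  have hpos : 0 < normSq (1 - z) := normSq_pos.2 hne
  -- With denominators cleared the claim is `|z|² < 1`.
  rw [one_div (1 - z), inv_re, lt_div_iff₀ hpos]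
  rw [normSq_apply] at *
  simp only [sub_re, one_re, sub_im, one_im]
  nlinarith

open Polynomial in
/-- If all roots of `H` lie in the open unit disc then `2 H'(1) ≠ (deg H) H(1)`. -/
theorem Polynomial.two_mul_eval_derivative_ne {H : ℂ[X]} (hH : 1 ≤ H.natDegree)
    (hroots : ∀ z, H.IsRoot z → ‖z‖ < 1) :
    2 * H.derivative.eval 1 ≠ H.natDegree * H.eval 1 := by
  have h1 : H.eval 1 ≠ 0 := by
    intro h
    have := hroots 1 h
    simp at this
  -- Logarithmic derivative: `H'(1) / H(1) = ∑ 1 / (1 - z)` over the roots, and each term has real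
  -- part above `1 / 2`.
  have hsum := (IsAlgClosed.splits H).eval_derivative_div_eval_of_ne_zero h1
  have hcard : H.roots.card = H.natDegree := IsAlgClosed.card_roots_eq_natDegree
  intro h
  have hdiv : H.derivative.eval 1 / H.eval 1 = (H.natDegree : ℂ) / 2 := by
    field_simp
    linear_combination h
  have hre : ∀ s : Multiset ℂ, (∀ z ∈ s, ‖z‖ < 1) → s ≠ 0 →
      (s.card : ℝ) / 2 < (s.map fun z => 1 / (1 - z)).sum.re := by
    intro s
    induction s using Multiset.induction with
    | empty => simp
    | cons a s ih =>
      intro hs _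
      have ha := Complex.half_lt_re_one_div_one_sub (hs a (Multiset.mem_cons_self a s))
      rw [Multiset.map_cons, Multiset.sum_cons, Complex.add_re, Multiset.card_cons]
      push_cast
      rcases eq_or_ne s 0 with rfl | hs0
      · simp only [Multiset.card_zero, Multiset.map_zero, Multiset.sum_zero, Complex.zero_re]
        push_cast
        linarith
      · have := ih (fun z hz => hs z (Multiset.mem_cons_of_mem hz)) hs0
        linarith
  have := hre H.roots (fun z hz => hroots z (isRoot_of_mem_roots hz))
    (by intro h0; rw [h0] at hcard; simp at hcard; omega)
  rw [← hsum, hdiv, hcard] at this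
  have h3 : ((H.natDegree : ℂ) / 2).re = (H.natDegree : ℝ) / 2 := by
    rw [show ((H.natDegree : ℂ) / 2) = (((H.natDegree : ℝ) / 2 : ℝ) : ℂ) by push_cast; rfl,
      Complex.ofReal_re]
  rw [h3] at this
  exact lt_irrefl _ this

open Polynomial in
/-- The self-reciprocal form of Bernstein's inequality: if `|P| ≤ M` on the unit circle and
`deg P ≤ d` then `|2 P'(1) - d P(1)| ≤ d M`. -/
theorem Polynomial.norm_two_mul_eval_derivative_sub_le {P : ℂ[X]} {d : ℕ} {M : ℝ} (hd : 1 ≤ d)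
    (hP : P.natDegree ≤ d) (hM : ∀ z : ℂ, ‖z‖ = 1 → ‖P.eval z‖ ≤ M) :
    ‖2 * P.derivative.eval 1 - d * P.eval 1‖ ≤ d * M := by
  by_contra! hlt
  have hd0 : (0 : ℝ) < d := by exact_mod_cast hd
  have hdC : (d : ℂ) ≠ 0 := by exact_mod_cast hd0.ne'
  -- This `c` makes `H = P - c X ^ d` satisfy `2 H'(1) = d H(1)`; since `|c| > M`, `H` has degree
  -- exactly `d` and no root outside the open disc.
  obtain ⟨c, hc⟩ : ∃ c : ℂ, c = (2 * P.derivative.eval 1 - d * P.eval 1) / d := ⟨_, rfl⟩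
  have hcM : M < ‖c‖ := by
    rw [hc, norm_div, Complex.norm_natCast, lt_div_iff₀ hd0]
    linarith
  obtain ⟨hcoeff, hout⟩ := norm_eval_le_mul_norm_pow hP hM
  have hHd : (P - C c * X ^ d).coeff d ≠ 0 := by
    rw [coeff_sub, coeff_C_mul, coeff_X_pow_self, mul_one, sub_ne_zero]
    intro h
    rw [h] at hcoeff
    linarith
  have hdeg : (P - C c * X ^ d).natDegree = d :=
    le_antisymm ((natDegree_sub_le _ _).trans (max_le hP (natDegree_C_mul_X_pow_le c d)))
      (le_natDegree_of_ne_zero hHd)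
  refine two_mul_eval_derivative_ne (H := P - C c * X ^ d) (by omega) ?_ ?_
  · intro z hz
    by_contra! hz1
    have h1 := hout z hz1
    have h2 : P.eval z = c * z ^ d := by
      have : P.eval z - c * z ^ d = 0 := by simpa [IsRoot] using hz
      linear_combination this
    rw [h2, norm_mul, norm_pow] at h1
    have : 0 < ‖z‖ ^ d := by positivity
    have := le_of_mul_le_mul_right h1 this
    linarith
  · rw [hdeg]
    have : c * d = 2 * P.derivative.eval 1 - d * P.eval 1 := by rw [hc]; field_simp
    simp only [derivative_sub, derivative_C_mul, derivative_X_pow, eval_sub, eval_mul, eval_C,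
      eval_pow, eval_X, one_pow, eval_natCast, map_natCast]
    linear_combination -this

/-! ### Homogeneous polynomials on circles -/

/-- Scaling the variables of a homogeneous polynomial by `c` multiplies its values by `c ^ d`. -/
theorem MvPolynomial.IsHomogeneous.eval₂_const_smul {σ R S : Type*} [CommSemiring R]
    [CommSemiring S] {F : MvPolynomial σ R} {d : ℕ} (hF : F.IsHomogeneous d) (φ : R →+* S) (c : S)
    (y : σ → S) : F.eval₂ φ (c • y) = c ^ d * F.eval₂ φ y := by
  rw [MvPolynomial.eval₂_eq, MvPolynomial.eval₂_eq, Finset.mul_sum]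
  refine Finset.sum_congr rfl fun m hm => ?_
  have hdeg : ∑ i ∈ m.support, m i = d := by
    have := hF (MvPolynomial.mem_support_iff.1 hm)
    rwa [Finsupp.weight_apply, Finsupp.sum, Finset.sum_congr rfl
      (fun i _ => show m i • (1 : σ → ℕ) i = m i by simp)] at this
  simp only [Pi.smul_apply, smul_eq_mul, mul_pow, Finset.prod_mul_distrib, Finset.prod_pow_eq_pow_sum,
    hdeg]
  ring

open MvPolynomial in
/-- Restricting a homogeneous real polynomial to a pair of vectors, in the complex coordinate
`z = exp (2 i t)` of the circle. -/
theorem MvPolynomial.IsHomogeneous.norm_deriv_circle_le {σ : Type*} {F : MvPolynomial σ ℝ} {d : ℕ}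
    (hd : 1 ≤ d) (hF : F.IsHomogeneous d) (x v : σ → ℝ) {M p' : ℝ}
    (hM : ∀ t : ℝ, |eval (fun j => Real.cos t * x j + Real.sin t * v j) F| ≤ M)
    (hp : HasDerivAt (fun t : ℝ => eval (fun j => Real.cos t * x j + Real.sin t * v j) F) p' 0) :
    |p'| ≤ d * M := by
  -- For `z = exp (i t) ^ 2`, `exp (i t) (cos t x + sin t v) = z (x - i v) / 2 + (x + i v) / 2` is
  -- affine in `z`.
  let L : σ → Polynomial ℂ := fun j =>
    Polynomial.C (((x j : ℂ) - Complex.I * v j) / 2) * Polynomial.X +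
      Polynomial.C (((x j : ℂ) + Complex.I * v j) / 2)
  let P : Polynomial ℂ := MvPolynomial.aeval L (map Complex.ofRealHom F)
  have hPdeg : P.natDegree ≤ d := by
    have := MvPolynomial.aeval_natDegree_le (map Complex.ofRealHom F) (m := d) (n := 1)
      (hF.map _).totalDegree_le L (fun j => Polynomial.natDegree_linear_le)
    simpa using this
  have hcast : ∀ y : σ → ℝ, ((eval y F : ℝ) : ℂ) = F.eval₂ Complex.ofRealHom (fun j => (y j : ℂ)) :=
    fun y => MvPolynomial.eval₂_comp_left Complex.ofRealHom (RingHom.id ℝ) y F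
  have heval : ∀ t : ℝ, P.eval (Complex.exp (2 * t * Complex.I)) =
      Complex.exp (d * t * Complex.I) *
        (eval (fun j => Real.cos t * x j + Real.sin t * v j) F : ℝ) := by
    intro t
    have h1 : P.eval (Complex.exp (2 * t * Complex.I)) =
        F.eval₂ Complex.ofRealHom (fun j => (L j).eval (Complex.exp (2 * t * Complex.I))) := by
      simp only [P]
      rw [← Polynomial.coe_evalRingHom, MvPolynomial.map_aeval, MvPolynomial.coe_eval₂Hom,
        MvPolynomial.eval₂_map]
      congr 1
      ext r
      simp
    have h2 : (fun j => (L j).eval (Complex.exp (2 * t * Complex.I))) =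
        Complex.exp (t * Complex.I) • fun j => ((Real.cos t * x j + Real.sin t * v j : ℝ) : ℂ) := by
      funext j
      have e1 : Complex.exp (2 * t * Complex.I) = Complex.exp (t * Complex.I) ^ 2 := by
        rw [← Complex.exp_nat_mul]; congr 1; push_cast; ring
      have e2 : Complex.exp (-t * Complex.I) * Complex.exp (t * Complex.I) = 1 := by
        rw [← Complex.exp_add]; simp
      simp only [L, Pi.smul_apply, smul_eq_mul, Polynomial.eval_add, Polynomial.eval_mul,
        Polynomial.eval_C, Polynomial.eval_X, e1]
      push_cast
      rw [Complex.cos, Complex.sin]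
      linear_combination (-((x j : ℂ) + Complex.I * v j) / 2) * e2
    have e3 : Complex.exp (d * t * Complex.I) = Complex.exp (t * Complex.I) ^ d := by
      rw [← Complex.exp_nat_mul]; congr 1; ring
    rw [h1, h2, hcast, e3]
    exact hF.eval₂_const_smul _ _ _
  have hunit : ∀ z : ℂ, ‖z‖ = 1 → ‖P.eval z‖ ≤ M := by
    intro z hz
    have hz' : z = Complex.exp (2 * ((z.arg / 2 : ℝ) : ℂ) * Complex.I) := by
      have h := Complex.norm_mul_exp_arg_mul_I z
      rw [hz, Complex.ofReal_one, one_mul] at h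
      rw [← h]
      congr 1
      rw [h]
      push_cast
      ring
    rw [hz', heval, norm_mul]
    have : ‖Complex.exp (d * ((z.arg / 2 : ℝ) : ℂ) * Complex.I)‖ = 1 := by
      have := Complex.norm_exp_ofReal_mul_I (d * (z.arg / 2))
      simpa using this
    rw [this, one_mul, Complex.norm_real]
    exact hM _
  have hB := Polynomial.norm_two_mul_eval_derivative_sub_le hd hPdeg hunit
  have hL : HasDerivAt (fun t : ℝ => P.eval (Complex.exp (2 * t * Complex.I)))
      (P.derivative.eval 1 * (2 * Complex.I)) 0 := by
    have h1 : HasDerivAt (fun t : ℝ => Complex.exp (2 * t * Complex.I)) (2 * Complex.I) 0 := by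
      have h0 : HasDerivAt (fun t : ℝ => 2 * (t : ℂ) * Complex.I) (2 * 1 * Complex.I) 0 :=
        ((Complex.ofRealCLM.hasDerivAt (x := (0 : ℝ))).const_mul 2).mul_const _
      simpa using h0.cexp
    have h2 := (P.hasDerivAt (Complex.exp (2 * ((0 : ℝ) : ℂ) * Complex.I))).comp (0 : ℝ) h1
    simpa [Function.comp_def] using h2
  have hR : HasDerivAt (fun t : ℝ => Complex.exp (d * t * Complex.I) *
        (eval (fun j => Real.cos t * x j + Real.sin t * v j) F : ℝ))
      (d * Complex.I * P.eval 1 + p') 0 := by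
    have h0 : HasDerivAt (fun t : ℝ => (d : ℂ) * (t : ℂ) * Complex.I) (d * 1 * Complex.I) 0 :=
      ((Complex.ofRealCLM.hasDerivAt (x := (0 : ℝ))).const_mul _).mul_const _
    have h1 := h0.cexp.mul hp.ofReal_comp
    have h2 := heval 0
    have h3 : P.eval 1 = ((eval (fun j => Real.cos 0 * x j + Real.sin 0 * v j) F : ℝ) : ℂ) := by
      simpa using h2
    rw [h3]
    refine h1.congr_deriv ?_
    simp only [Complex.ofReal_zero, mul_zero, zero_mul, Complex.exp_zero, one_mul, mul_one]
  -- Differentiating `P(exp (2 i t)) = exp (i d t) F(...)` at `0` gives `2 i P'(1) = i d P(1) + p'`.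
  have hEq := hL.unique (hR.congr_of_eventuallyEq (Filter.Eventually.of_forall heval))
  have hfin : (2 * P.derivative.eval 1 - d * P.eval 1) * Complex.I = p' := by
    linear_combination hEq
  have hn := congrArg norm hfin
  rw [norm_mul, Complex.norm_I, mul_one, Complex.norm_real, Real.norm_eq_abs] at hn
  rw [← hn]
  exact hB

namespace GridK

variable {n q : ℕ}

/-! ### Regularity and the sup norm -/

theorem differentiable_eval {m : ℕ} (p : MvPolynomial (Fin m) ℝ) :
    Differentiable ℝ fun x : Euc m => MvPolynomial.eval x.ofLp p := by
  induction p using MvPolynomial.induction_on with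
  | C a => simp
  | add p q hp hq => simpa using! hp.add hq
  | mul_X p i hp =>
    have : Differentiable ℝ fun x : Euc m => x i := by fun_prop
    simpa using! hp.mul this

theorem differentiable_evalSys (f : PolySystem n q) : Differentiable ℝ (evalSys f) := by
  rw [differentiable_euclidean]
  exact fun i => differentiable_eval (f i)

theorem bddAbove_supNorm (f : PolySystem n q) :
    BddAbove (Set.range fun x : sph n => ‖fun i => MvPolynomial.eval x.1.ofLp (f i)‖) := by
  have : CompactSpace (sph n) := isCompact_iff_compactSpace.1 (isCompact_sphere 0 1)
  refine (isCompact_range ?_).bddAbove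
  refine Continuous.norm (continuous_pi fun i => ?_)
  exact (differentiable_eval (f i)).continuous.comp continuous_subtype_val

theorem abs_eval_le_supNorm (f : PolySystem n q) {x : Euc (n + 1)} (hx : x ∈ sph n) (i : Fin q) :
    |MvPolynomial.eval x.ofLp (f i)| ≤ supNorm f :=
  (norm_le_pi_norm (fun i => MvPolynomial.eval x.ofLp (f i)) i).trans
    (le_ciSup (bddAbove_supNorm f) ⟨x, hx⟩)

theorem supNorm_nonneg (f : PolySystem n q) : 0 ≤ supNorm f :=
  Real.iSup_nonneg fun _ => norm_nonneg _

theorem norm_le_sqrt_mul_of_abs_le {y : Euc q} {C : ℝ} (hC : 0 ≤ C) (hy : ∀ i, |y i| ≤ C) :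
    ‖y‖ ≤ √(q : ℝ) * C := by
  rw [EuclideanSpace.norm_eq]
  refine Real.sqrt_le_iff.2 ⟨by positivity, ?_⟩
  rw [mul_pow, Real.sq_sqrt (Nat.cast_nonneg q)]
  calc ∑ i, ‖y i‖ ^ 2 ≤ ∑ _i : Fin q, C ^ 2 :=
        Finset.sum_le_sum fun i _ => pow_le_pow_left₀ (norm_nonneg _) (hy i) 2
    _ = q * C ^ 2 := by simp

/-! ### Great circles and Bernstein's inequality on the sphere -/

/-- The great circle through `x` with direction `v`. -/
noncomputable def circle (x v : Euc (n + 1)) (t : ℝ) : Euc (n + 1) := Real.cos t • x + Real.sin t • v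

section circle

variable {x v : Euc (n + 1)}

@[simp]
theorem circle_zero (x v : Euc (n + 1)) : circle x v 0 = x := by simp [circle]

theorem hasDerivAt_circle (x v : Euc (n + 1)) (t : ℝ) :
    HasDerivAt (circle x v) (-Real.sin t • x + Real.cos t • v) t :=
  ((Real.hasDerivAt_cos t).smul_const x).add ((Real.hasDerivAt_sin t).smul_const v)

theorem norm_sq_combination (hx : ‖x‖ = 1) (hv : ‖v‖ = 1) (hxv : inner ℝ x v = 0) (a b : ℝ) :
    ‖a • x + b • v‖ ^ 2 = a ^ 2 + b ^ 2 := by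
  rw [norm_add_sq_real, inner_smul_left, inner_smul_right, hxv, norm_smul, norm_smul, hx, hv]
  simp

theorem norm_circle (hx : ‖x‖ = 1) (hv : ‖v‖ = 1) (hxv : inner ℝ x v = 0) (t : ℝ) :
    ‖circle x v t‖ = 1 := by
  have := norm_sq_combination hx hv hxv (Real.cos t) (Real.sin t)
  rw [Real.cos_sq_add_sin_sq] at this
  exact (pow_eq_one_iff_of_nonneg (norm_nonneg _) two_ne_zero).1 this

theorem norm_circle_sub_le (hx : ‖x‖ = 1) (hv : ‖v‖ = 1) (hxv : inner ℝ x v = 0) {t : ℝ}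
    (ht : 0 ≤ t) : ‖circle x v t - x‖ ≤ t := by
  have h : circle x v t - x = (Real.cos t - 1) • x + Real.sin t • v := by
    rw [circle, sub_smul, one_smul]; abel
  refine (pow_le_pow_iff_left₀ (norm_nonneg _) ht two_ne_zero).1 ?_
  rw [h, norm_sq_combination hx hv hxv]
  nlinarith [Real.one_sub_sq_div_two_le_cos (x := t), Real.cos_sq_add_sin_sq t]

theorem hasDerivAt_evalSys_circle (f : PolySystem n q) (x v : Euc (n + 1)) (t : ℝ) :
    HasDerivAt (fun t => evalSys f (circle x v t))
      (fderiv ℝ (evalSys f) (circle x v t) (-Real.sin t • x + Real.cos t • v)) t :=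
  (differentiable_evalSys f _).hasFDerivAt.comp_hasDerivAt t (hasDerivAt_circle x v t)

theorem hasDerivAt_evalSys_circle_apply (f : PolySystem n q) (x v : Euc (n + 1)) (t : ℝ)
    (i : Fin q) : HasDerivAt (fun t => evalSys f (circle x v t) i)
      (fderiv ℝ (evalSys f) (circle x v t) (-Real.sin t • x + Real.cos t • v) i) t :=
  (EuclideanSpace.proj i : Euc q →L[ℝ] ℝ).hasFDerivAt.comp_hasDerivAt t
    (hasDerivAt_evalSys_circle f x v t)

/-- **Bernstein's inequality** on the sphere. -/
theorem abs_fderiv_evalSys_le {d : Fin q → ℕ} {f : PolySystem n q} (hf : IsHomSystem d f)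
    (hd : ∀ i, 1 ≤ d i) (hx : ‖x‖ = 1) (hv : ‖v‖ = 1) (hxv : inner ℝ x v = 0) (i : Fin q) :
    |fderiv ℝ (evalSys f) x v i| ≤ d i * supNorm f := by
  refine (hf i).norm_deriv_circle_le (hd i) x.ofLp v.ofLp (fun t => ?_) ?_
  · exact abs_eval_le_supNorm f (mem_sphere_zero_iff_norm.2 (norm_circle hx hv hxv t)) i
  · have := hasDerivAt_evalSys_circle_apply f x v 0 i
    simp only [circle_zero, Real.sin_zero, Real.cos_zero, neg_zero, zero_smul, zero_add,
      one_smul] at this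
    exact this

theorem abs_fderiv_evalSys_le_mul_norm {d : Fin q → ℕ} {f : PolySystem n q} (hf : IsHomSystem d f)
    (hd : ∀ i, 1 ≤ d i) (hx : ‖x‖ = 1) (hxv : inner ℝ x v = 0) (i : Fin q) :
    |fderiv ℝ (evalSys f) x v i| ≤ d i * supNorm f * ‖v‖ := by
  rcases eq_or_ne v 0 with rfl | hv
  · simp
  have hv0 : 0 < ‖v‖ := norm_pos_iff.2 hv
  have h := abs_fderiv_evalSys_le hf hd hx (v := ‖v‖⁻¹ • v)
    (by rw [norm_smul, norm_inv, norm_norm, inv_mul_cancel₀ hv0.ne'])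
    (by rw [inner_smul_right, hxv, mul_zero]) i
  rw [map_smul, PiLp.smul_apply, smul_eq_mul, abs_mul, abs_inv, abs_norm, inv_mul_le_iff₀ hv0] at h
  linarith

/-- The part of `y` orthogonal to `x` has length `sin (angle x y)`, and normalising it gives `v`. If
it vanishes, `y = ± x` and it determines no direction, hence the first alternative. -/
theorem exists_circle_eq {y : Euc (n + 1)} (hx : ‖x‖ = 1) (hy : ‖y‖ = 1) :
    (∃ c : ℝ, y = c • x) ∨ ∃ v : Euc (n + 1), ‖v‖ = 1 ∧ inner ℝ x v = 0 ∧
      y = circle x v (InnerProductGeometry.angle x y) := by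
  have hcos : Real.cos (InnerProductGeometry.angle x y) = inner ℝ x y := by
    rw [InnerProductGeometry.cos_angle, hx, hy]; simp
  obtain ⟨w, hw⟩ : ∃ w, w = y - (inner ℝ x y : ℝ) • x := ⟨_, rfl⟩
  have hxw : inner ℝ x w = 0 := by
    rw [hw, inner_sub_right, inner_smul_right, real_inner_self_eq_norm_sq, hx]; ring
  have hyw : y = (inner ℝ x y : ℝ) • x + w := by rw [hw]; abel
  have hnorm : ‖w‖ = Real.sin (InnerProductGeometry.angle x y) := by
    refine (pow_left_inj₀ (norm_nonneg _)
      (InnerProductGeometry.sin_angle_nonneg x y) two_ne_zero).1 ?_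
    rw [Real.sin_sq, hcos, hw, norm_sub_sq_real, inner_smul_right, norm_smul, hx, hy,
      real_inner_comm]
    simp
    ring
  rcases eq_or_ne w 0 with h0 | h0
  · exact Or.inl ⟨inner ℝ x y, by rw [h0, add_zero] at hyw; exact hyw⟩
  · have hpos : ‖w‖ ≠ 0 := norm_ne_zero_iff.2 h0
    refine Or.inr ⟨‖w‖⁻¹ • w, ?_, ?_, ?_⟩
    · rw [norm_smul, norm_inv, norm_norm, inv_mul_cancel₀ hpos]
    · rw [inner_smul_right, hxw, mul_zero]
    · rw [circle, ← hnorm, hcos, smul_smul, mul_inv_cancel₀ hpos, one_smul]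
      exact hyw

end circle

theorem le_maxDegree (d : Fin q → ℕ) (i : Fin q) : d i ≤ maxDegree d :=
  Finset.le_sup (Finset.mem_univ i)

/-- Near a zero `x` of `f`, the values of `f` are bounded by the geodesic distance to `x`. -/
theorem norm_evalSys_le_of_zero {d : Fin q → ℕ} {f : PolySystem n q} (hf : IsHomSystem d f)
    (hd : ∀ i, 1 ≤ d i) {x y : Euc (n + 1)} (hx : ‖x‖ = 1) (hy : ‖y‖ = 1)
    (h0 : evalSys f x = 0) :
    ‖evalSys f y‖ ≤ √(q : ℝ) * (maxDegree d * supNorm f * InnerProductGeometry.angle x y) := by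
  have hM := supNorm_nonneg f
  have hθ := InnerProductGeometry.angle_nonneg x y
  refine norm_le_sqrt_mul_of_abs_le (by positivity) fun i => ?_
  have h0i : MvPolynomial.eval x.ofLp (f i) = 0 := congrArg (fun z : Euc q => z i) h0
  rcases exists_circle_eq hx hy with ⟨c, rfl⟩ | ⟨v, hv, hxv, hyv⟩
  -- By homogeneity the line through a zero consists of zeros, which settles the antipode.
  · have : evalSys f (c • x) i = 0 := by
      have := (hf i).eval₂_const_smul (RingHom.id ℝ) c x.ofLp
      change MvPolynomial.eval (c • x.ofLp) (f i) = 0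
      rw [MvPolynomial.eval₂_id, MvPolynomial.eval₂_id, h0i, mul_zero] at this
      exact this
    rw [this, abs_zero]
    positivity
  · have hderiv : ∀ t, HasDerivAt (fun t => evalSys f (circle x v t) i)
        (fderiv ℝ (evalSys f) (circle x v t) (-Real.sin t • x + Real.cos t • v) i) t := fun t =>
      hasDerivAt_evalSys_circle_apply f x v t i
    -- The velocity of the circle is a unit tangent vector at every time, so Bernstein applies all
    -- along it.
    have hb : ∀ t, ‖fderiv ℝ (evalSys f) (circle x v t) (-Real.sin t • x + Real.cos t • v) i‖ ≤
        maxDegree d * supNorm f := by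
      intro t
      have hu : ‖-Real.sin t • x + Real.cos t • v‖ = 1 := by
        have := norm_sq_combination hx hv hxv (-Real.sin t) (Real.cos t)
        rw [neg_sq, Real.sin_sq_add_cos_sq] at this
        exact (pow_eq_one_iff_of_nonneg (norm_nonneg _) two_ne_zero).1 this
      refine (abs_fderiv_evalSys_le hf hd (norm_circle hx hv hxv t) hu ?_ i).trans ?_
      · rw [circle]
        simp only [inner_add_left, inner_add_right, inner_smul_left, inner_smul_right, hxv,
          real_inner_comm x v, real_inner_self_eq_norm_sq, hx, hv]
        simp
        ring
      · gcongr
        exact le_maxDegree d i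
    have := norm_image_sub_le_of_norm_deriv_le_segment' (a := 0)
      (b := InnerProductGeometry.angle x y) (fun t _ => (hderiv t).hasDerivWithinAt)
      (fun t _ => hb t) _ (Set.right_mem_Icc.2 hθ)
    rw [← hyv, circle_zero, h0, sub_zero] at this
    simpa using this

/-! ### The condition number -/

/-- The Moore-Penrose inverse is a right inverse of a surjective map. -/
theorem comp_pinv {V W : Type*} [NormedAddCommGroup V] [InnerProductSpace ℝ V] [CompleteSpace V]
    [NormedAddCommGroup W] [InnerProductSpace ℝ W] [FiniteDimensional ℝ W] [CompleteSpace W]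
    {A : V →L[ℝ] W} (hA : Function.Surjective A) (w : W) : A (pinv A w) = w := by
  -- If `A A* w = 0` then `‖A* w‖² = 0`, so `w` is orthogonal to the range of `A`, which is
  -- everything. Hence `inverse` is a true inverse, not its default `0`.
  have hinj : Function.Injective (A.comp (ContinuousLinearMap.adjoint A)) := by
    rw [injective_iff_map_eq_zero]
    intro w hw
    have h1 : ContinuousLinearMap.adjoint A w = 0 := by
      rw [← inner_self_eq_zero (𝕜 := ℝ), ContinuousLinearMap.adjoint_inner_left]
      change inner ℝ w ((A.comp (ContinuousLinearMap.adjoint A)) w) = 0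
      rw [hw, inner_zero_right]
    obtain ⟨u, rfl⟩ := hA w
    rw [← inner_self_eq_zero (𝕜 := ℝ), ← ContinuousLinearMap.adjoint_inner_left, h1,
      inner_zero_left]
  let e : W ≃L[ℝ] W := (LinearEquiv.ofInjectiveEndo
    (A.comp (ContinuousLinearMap.adjoint A)).toLinearMap hinj).toContinuousLinearEquiv
  have he : A.comp (ContinuousLinearMap.adjoint A) = (e : W →L[ℝ] W) := by ext; rfl
  change (A.comp (ContinuousLinearMap.adjoint A))
    ((A.comp (ContinuousLinearMap.adjoint A)).inverse w) = w
  rw [he, ContinuousLinearMap.inverse_equiv]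
  exact e.apply_symm_apply w

theorem degDiag_apply (d : Fin q → ℕ) (w : Euc q) (i : Fin q) : degDiag d w i = d i * w i := by
  rw [degDiag, Matrix.ofLp_toEuclideanCLM, Matrix.mulVec_diagonal]

/-- `‖D_x f† Δ‖⁻¹ ≤ ‖f‖_∞`. -/
theorem invNormPinv_le_supNorm {d : Fin q → ℕ} {f : PolySystem n q} (hf : IsHomSystem d f)
    (hd : ∀ i, 1 ≤ d i) (hq : 1 ≤ q) {x : Euc (n + 1)} (hx : ‖x‖ = 1) :
    invNormPinv d f x ≤ supNorm f := by
  have hM := supNorm_nonneg f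
  rw [invNormPinv]
  split_ifs with hs
  -- Test on the first basis vector: `D_x f (B w) = d₀ w`, and Bernstein in that coordinate gives
  -- `d₀ ≤ d₀ ‖f‖_∞ ‖B w‖`.
  · obtain ⟨w, hw⟩ : ∃ w : Euc q, w = EuclideanSpace.single ⟨0, hq⟩ 1 := ⟨_, rfl⟩
    obtain ⟨B, hB⟩ : ∃ B, B = (pinv (tangentDeriv f x)).comp (degDiag d) := ⟨_, rfl⟩
    have h1 : fderiv ℝ (evalSys f) x (B w) = degDiag d w := by
      rw [hB]; exact comp_pinv hs _
    have h2 := abs_fderiv_evalSys_le_mul_norm hf hd hx (v := (B w : Euc (n + 1)))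
      (Submodule.mem_orthogonal_singleton_iff_inner_right.1 (B w).2) ⟨0, hq⟩
    have hd0 : (0 : ℝ) < d ⟨0, hq⟩ := by exact_mod_cast hd _
    rw [h1, degDiag_apply, hw, PiLp.single_apply, if_pos rfl, mul_one, Nat.abs_cast, mul_assoc,
      ← hw] at h2
    have h3 : 1 ≤ supNorm f * ‖B w‖ := by
      have : (d ⟨0, hq⟩ : ℝ) * 1 ≤ d ⟨0, hq⟩ * (supNorm f * ‖B w‖) := by simpa using h2
      exact le_of_mul_le_mul_left this hd0
    have h4 : ‖B w‖ ≤ ‖B‖ := by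
      have := B.le_opNorm w
      rwa [hw, PiLp.norm_single, norm_one, mul_one, ← hw] at this
    have h5 : 1 ≤ supNorm f * ‖B‖ := h3.trans (by gcongr)
    rw [← hB]
    have hBpos : 0 < ‖B‖ := by
      rcases (norm_nonneg B).eq_or_lt with h | h
      · rw [← h] at h5; norm_num at h5
      · exact h
    rwa [inv_le_iff_one_le_mul₀ hBpos]
  · exact hM

variable {d : Fin q → ℕ} {f : PolySystem n q}

theorem norm_evalSys_le (f : PolySystem n q) {x : Euc (n + 1)} (hx : x ∈ sph n) :
    ‖evalSys f x‖ ≤ √(q : ℝ) * supNorm f :=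
  norm_le_sqrt_mul_of_abs_le (supNorm_nonneg f) fun i => abs_eval_le_supNorm f hx i

theorem max_norm_invNormPinv_nonneg (d : Fin q → ℕ) (f : PolySystem n q) (x : Euc (n + 1)) :
    0 ≤ max ‖evalSys f x‖ (invNormPinv d f x) :=
  (norm_nonneg _).trans (le_max_left _ _)

/-- Both entries of the maximum in the denominator are at most `√q ‖f‖_∞`, the second one by
Bernstein. -/
theorem one_le_localK (hf : IsHomSystem d f) (hd : ∀ i, 1 ≤ d i) (hq : 1 ≤ q) {x : Euc (n + 1)}
    (hx : x ∈ sph n) : 1 ≤ localK d f x := by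
  rw [localK]
  split_ifs with h
  · exact le_top
  · have hpos := (max_norm_invNormPinv_nonneg d f x).lt_of_ne' h
    rw [ENNReal.one_le_ofReal, one_le_div hpos]
    refine max_le (norm_evalSys_le f hx) ?_
    have hsq : 1 ≤ √(q : ℝ) := Real.one_le_sqrt.2 (by exact_mod_cast hq)
    exact (invNormPinv_le_supNorm hf hd hq (mem_sphere_zero_iff_norm.1 hx)).trans
      (le_mul_of_one_le_left (supNorm_nonneg f) hsq)

theorem sphere_nonempty (n : ℕ) : (sph n).Nonempty :=
  ⟨EuclideanSpace.single 0 1, by simp⟩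

theorem one_le_globalK (hf : IsHomSystem d f) (hd : ∀ i, 1 ≤ d i) (hq : 1 ≤ q) :
    1 ≤ globalK d f := by
  obtain ⟨x, hx⟩ := sphere_nonempty n
  exact (one_le_localK hf hd hq hx).trans (le_iSup (fun y : sph n => localK d f y.1) ⟨x, hx⟩)

/-- The regularity inequality. -/
theorem sqrt_mul_supNorm_le_globalK_mul_max (hK : globalK d f ≠ ⊤) {x : Euc (n + 1)}
    (hx : x ∈ sph n) :
    0 < max ‖evalSys f x‖ (invNormPinv d f x) ∧
      √(q : ℝ) * supNorm f ≤ (globalK d f).toReal * max ‖evalSys f x‖ (invNormPinv d f x) := by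
  have hle : localK d f x ≤ globalK d f := le_iSup (fun y : sph n => localK d f y.1) ⟨x, hx⟩
  rw [localK] at hle
  split_ifs at hle with h
  · exact absurd (top_le_iff.1 hle) hK
  · have hpos := (max_norm_invNormPinv_nonneg d f x).lt_of_ne' h
    exact ⟨hpos, (div_le_iff₀ hpos).1 ((ENNReal.ofReal_le_iff_le_toReal hK).1 hle)⟩

/-- A vanishing sup norm would force every denominator to `0`, where the local condition number is
`⊤`. -/
theorem supNorm_pos (hf : IsHomSystem d f) (hd : ∀ i, 1 ≤ d i) (hq : 1 ≤ q)
    (hK : globalK d f ≠ ⊤) : 0 < supNorm f := by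
  refine (supNorm_nonneg f).lt_of_ne' fun h0 => ?_
  obtain ⟨x, hx⟩ := sphere_nonempty n
  refine (sqrt_mul_supNorm_le_globalK_mul_max hK hx).1.not_ge (max_le ?_ ?_)
  · simpa [h0] using norm_evalSys_le f hx
  · exact h0 ▸ invNormPinv_le_supNorm hf hd hq (mem_sphere_zero_iff_norm.1 hx)

/-! ### Descent and existence of zeros -/

/-- The Newton direction `-D_y f† f(y)` and its length. -/
theorem exists_newton_direction (hd : ∀ i, 1 ≤ d i) {y : Euc (n + 1)} {s : ℝ} (hs : 0 < s)
    (hsy : s ≤ invNormPinv d f y) :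
    ∃ v : Euc (n + 1), inner ℝ y v = 0 ∧ fderiv ℝ (evalSys f) y v = -evalSys f y ∧
      s * ‖v‖ ≤ ‖evalSys f y‖ := by
  rw [invNormPinv] at hsy
  split_ifs at hsy with hsurj
  swap
  · linarith
  obtain ⟨B, hB⟩ : ∃ B, B = (pinv (tangentDeriv f y)).comp (degDiag d) := ⟨_, rfl⟩
  rw [← hB] at hsy
  -- `w = Δ⁻¹ f(y)`, so `B w = D_y f† f(y)`; dividing by degrees `≥ 1` does not increase the norm.
  obtain ⟨w, hw⟩ : ∃ w : Euc q, w = WithLp.toLp 2 fun i => evalSys f y i / d i := ⟨_, rfl⟩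
  have hd0 : ∀ i, (1 : ℝ) ≤ d i := fun i => by exact_mod_cast hd i
  have hΔ : degDiag d w = evalSys f y := by
    ext i
    rw [degDiag_apply, hw]
    exact mul_div_cancel₀ _ (by linarith [hd0 i])
  have hwn : ‖w‖ ≤ ‖evalSys f y‖ := by
    rw [EuclideanSpace.norm_eq, EuclideanSpace.norm_eq]
    refine Real.sqrt_le_sqrt (Finset.sum_le_sum fun i _ => ?_)
    refine pow_le_pow_left₀ (norm_nonneg _) ?_ 2
    rw [hw, norm_div, Real.norm_natCast]
    exact div_le_self (norm_nonneg _) (hd0 i)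
  -- Positivity of `s` excludes the default value `0⁻¹ = 0`.
  have hBpos : 0 < ‖B‖ := inv_pos.1 (hs.trans_le hsy)
  refine ⟨-(B w : Euc (n + 1)), ?_, ?_, ?_⟩
  · rw [inner_neg_right, Submodule.mem_orthogonal_singleton_iff_inner_right.1 (B w).2, neg_zero]
  · rw [map_neg, ← hΔ, hB]
    exact congrArg _ (comp_pinv hsurj _)
  · rw [norm_neg]
    have h1 : ‖(B w : Euc (n + 1))‖ ≤ ‖B‖ * ‖w‖ := B.le_opNorm w
    calc s * ‖(B w : Euc (n + 1))‖ ≤ ‖B‖⁻¹ * (‖B‖ * ‖w‖) := by gcongr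
      _ = ‖w‖ := by rw [← mul_assoc, inv_mul_cancel₀ hBpos.ne', one_mul]
      _ ≤ _ := hwn

/-- `‖f‖` decreases with slope at least `invNormPinv d f y` at a point `y` of the sphere that is
not a zero. -/
theorem exists_norm_evalSys_add_lt (hd : ∀ i, 1 ≤ d i) {y : Euc (n + 1)} (hy : ‖y‖ = 1)
    (hfy : evalSys f y ≠ 0) {c s : ℝ} (hc : 0 < c) (hcs : c < s) (hsy : s ≤ invNormPinv d f y) :
    ∃ z ∈ sph n, ‖evalSys f z‖ + c * ‖z - y‖ < ‖evalSys f y‖ := by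
  obtain ⟨v, hyv, hDv, hv⟩ := exists_newton_direction hd (hc.trans hcs) hsy
  have hfpos : 0 < ‖evalSys f y‖ := norm_pos_iff.2 hfy
  have hv0 : 0 < ‖v‖ := by
    refine norm_pos_iff.2 fun h => hfy ?_
    rw [h, map_zero] at hDv
    exact neg_eq_zero.1 hDv.symm
  obtain ⟨a, ha⟩ : ∃ a : ℝ, a = ‖v‖⁻¹ := ⟨_, rfl⟩
  have ha0 : 0 < a := ha ▸ inv_pos.2 hv0
  have hsa : s ≤ a * ‖evalSys f y‖ := by
    rwa [ha, mul_comm, ← div_eq_mul_inv, le_div_iff₀ hv0]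
  have hu : ‖a • v‖ = 1 := by
    rw [norm_smul, Real.norm_of_nonneg ha0.le, ha, inv_mul_cancel₀ hv0.ne']
  have hyu : inner ℝ y (a • v) = 0 := by rw [inner_smul_right, hyv, mul_zero]
  have hder := hasDerivAt_evalSys_circle f y (a • v) 0
  simp only [circle_zero, Real.sin_zero, Real.cos_zero, neg_zero, zero_smul, zero_add,
    one_smul, map_smul, hDv] at hder
  -- To first order `f` becomes `(1 - t a) f(y)`, a loss of at least `s t` in norm. The error takes
  -- `(s - c) t / 2` and the penalty at most `c t`, leaving a net loss of at least `(s - c) t / 2`.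
  have hlit := hder.isLittleO.def (show 0 < (s - c) / 2 by linarith)
  have hev : ∀ᶠ t : ℝ in nhdsWithin 0 (Set.Ioi 0), 0 < t ∧ t * a ≤ 1 := by
    filter_upwards [Ioo_mem_nhdsGT (inv_pos.2 ha0)] with t ht
    exact ⟨ht.1, by rw [← le_div_iff₀ ha0, one_div]; exact ht.2.le⟩
  obtain ⟨t, ht, ht0, hta⟩ := ((hlit.filter_mono nhdsWithin_le_nhds).and hev).exists
  refine ⟨circle y (a • v) t, mem_sphere_zero_iff_norm.2 (norm_circle hy hu hyu t), ?_⟩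
  have h1 := norm_circle_sub_le hy hu hyu ht0.le
  simp only [circle_zero, sub_zero, Real.norm_of_nonneg ht0.le] at ht
  have h2 : evalSys f (circle y (a • v) t) =
      (evalSys f (circle y (a • v) t) - evalSys f y - t • a • -evalSys f y) +
        (1 - t * a) • evalSys f y := by
    rw [sub_smul, one_smul, smul_neg, smul_neg, smul_smul]; abel
  have h3 : ‖evalSys f (circle y (a • v) t)‖ ≤
      (s - c) / 2 * t + (1 - t * a) * ‖evalSys f y‖ := by
    rw [h2]
    refine (norm_add_le _ _).trans (add_le_add ht ?_)
    rw [norm_smul, Real.norm_of_nonneg (by linarith)]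
  have h4 : c * ‖circle y (a • v) t - y‖ ≤ c * t := by gcongr
  nlinarith

/-- If `f` has slope at least `s` on the sublevel set of `x`, then `f` has a zero close to `x`. -/
theorem exists_mem_zeroSet (hd : ∀ i, 1 ≤ d i) {x : Euc (n + 1)} (hx : x ∈ sph n) {c s : ℝ}
    (hc : 0 < c) (hcs : c < s)
    (hslope : ∀ y ∈ sph n, ‖evalSys f y‖ ≤ ‖evalSys f x‖ → s ≤ invNormPinv d f y) :
    ∃ z ∈ zeroSet f, c * ‖z - x‖ ≤ ‖evalSys f x‖ := by
  have hcont : Continuous fun z => ‖evalSys f z‖ + c * ‖z - x‖ := by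
    have := (differentiable_evalSys f).continuous
    fun_prop
  -- As in Ekeland's variational principle: comparison with `x` puts the minimiser in the sublevel
  -- set, and a descent step from a nonzero value would beat it by the triangle inequality.
  obtain ⟨z, hz, hmin⟩ := (isCompact_sphere (0 : Euc (n + 1)) 1).exists_isMinOn ⟨x, hx⟩
    hcont.continuousOn
  have hzx : ‖evalSys f z‖ + c * ‖z - x‖ ≤ ‖evalSys f x‖ := by simpa using hmin hx
  have hcz : 0 ≤ c * ‖z - x‖ := by positivity
  have h0 : evalSys f z = 0 := by
    by_contra hfz
    obtain ⟨w, hw, hlt⟩ := exists_norm_evalSys_add_lt hd (mem_sphere_zero_iff_norm.1 hz) hfz hc hcs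
      (hslope z hz (by linarith))
    have h1 : ‖evalSys f z‖ + c * ‖z - x‖ ≤ ‖evalSys f w‖ + c * ‖w - x‖ := hmin hw
    have h2 : c * ‖w - x‖ ≤ c * (‖w - z‖ + ‖z - x‖) := by
      gcongr
      exact norm_sub_le_norm_sub_add_norm_sub w z x
    linarith
  exact ⟨z, ⟨hz, h0⟩, by linarith [norm_nonneg (evalSys f z)]⟩

/-! ### Grid points against zeros -/

theorem norm_sub_le_angle {x y : Euc (n + 1)} (hx : ‖x‖ = 1) (hy : ‖y‖ = 1) :
    ‖x - y‖ ≤ InnerProductGeometry.angle x y := by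
  have hθ := InnerProductGeometry.angle_nonneg x y
  refine (pow_le_pow_iff_left₀ (norm_nonneg _) hθ two_ne_zero).1 ?_
  have hcos : Real.cos (InnerProductGeometry.angle x y) = inner ℝ x y := by
    rw [InnerProductGeometry.cos_angle, hx, hy]; simp
  rw [norm_sub_sq_real, hx, hy, ← hcos]
  linarith [Real.one_sub_sq_div_two_le_cos (x := InnerProductGeometry.angle x y)]

/-- A zero of `f` has a selected grid point within distance `δ`. -/
theorem exists_mem_selected (hf : IsHomSystem d f) (hd : ∀ i, 1 ≤ d i) (hq : 1 ≤ q)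
    {δ Q : ℝ} {G : Finset (Euc (n + 1))} (hG : IsNet δ G) (hM : 0 < supNorm f)
    (hQ : supNorm f ≤ Q) {z : Euc (n + 1)} (hz : z ∈ zeroSet f) :
    ∃ x ∈ selected d f G Q δ, ‖z - x‖ ≤ δ := by
  obtain ⟨x, hxG, hxz⟩ := hG.2 z hz.1
  have hz1 := mem_sphere_zero_iff_norm.1 hz.1
  have hx1 := mem_sphere_zero_iff_norm.1 (hG.1 hxG)
  refine ⟨x, ⟨hxG, ?_⟩, (norm_sub_le_angle hz1 hx1).trans hxz.le⟩
  have hq0 : (0 : ℝ) < √(q : ℝ) := Real.sqrt_pos.2 (by exact_mod_cast hq)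
  have hD : (0 : ℝ) < maxDegree d := by
    exact_mod_cast (hd ⟨0, hq⟩).trans (le_maxDegree d _)
  have hQ0 : 0 < Q := hM.trans_le hQ
  have hθ := InnerProductGeometry.angle_nonneg z x
  rw [div_lt_iff₀ (by positivity)]
  calc ‖evalSys f x‖ ≤ √(q : ℝ) * (maxDegree d * supNorm f * InnerProductGeometry.angle z x) :=
        norm_evalSys_le_of_zero hf hd hz1 hx1 hz.2
    _ ≤ √(q : ℝ) * (maxDegree d * Q * InnerProductGeometry.angle z x) := by gcongr
    _ < √(q : ℝ) * (maxDegree d * Q * δ) := by gcongr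
    _ = maxDegree d * δ * (√(q : ℝ) * Q) := by ring

/-- A selected grid point is close to a zero of `f`. -/
theorem exists_mem_zeroSet_of_mem_selected (hf : IsHomSystem d f) (hd : ∀ i, 1 ≤ d i)
    (hq : 1 ≤ q) (hK : globalK d f ≠ ⊤) {δ Q : ℝ} {G : Finset (Euc (n + 1))} (hG : IsNet δ G)
    (hKδ : 4 * (maxDegree d * (globalK d f).toReal * δ) < 1) (hQ₁ : 0.99 * Q ≤ supNorm f)
    (hQ₂ : supNorm f ≤ Q) {x : Euc (n + 1)} (hx : x ∈ selected d f G Q δ) :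
    ∃ z ∈ zeroSet f, ‖x - z‖ ≤ 3 / 2 * maxDegree d * (globalK d f).toReal * δ := by
  have hM := supNorm_pos hf hd hq hK
  have hk1 : 1 ≤ (globalK d f).toReal := by
    simpa using ENNReal.toReal_mono hK (one_le_globalK hf hd hq)
  have hq0 : (0 : ℝ) < √(q : ℝ) := Real.sqrt_pos.2 (by exact_mod_cast hq)
  obtain ⟨k, hk⟩ : ∃ k, k = (globalK d f).toReal := ⟨_, rfl⟩
  obtain ⟨m, hm⟩ : ∃ m, m = √(q : ℝ) * supNorm f := ⟨_, rfl⟩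
  obtain ⟨r, hr⟩ : ∃ r, r = maxDegree d * δ := ⟨_, rfl⟩
  rw [← hk] at hk1 hKδ ⊢
  have hm0 : 0 < m := hm ▸ mul_pos hq0 hM
  have hk0 : 0 < k := by linarith
  have hxs := hG.1 hx.1
  have hfx : ‖evalSys f x‖ < r * (√(q : ℝ) * Q) := by
    rw [hr]
    exact (div_lt_iff₀ (mul_pos hq0 (hM.trans_le hQ₂))).1 hx.2
  have hqQ : 0.99 * (√(q : ℝ) * Q) ≤ m := by rw [hm]; nlinarith
  have hqQ0 : 0 < √(q : ℝ) * Q := mul_pos hq0 (hM.trans_le hQ₂)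
  have hr0 : 0 < r := by
    by_contra! h
    nlinarith [norm_nonneg (evalSys f x)]
  have hrk : 4 * (r * k) < 1 := by rw [hr]; linarith
  have hfx' : 0.99 * ‖evalSys f x‖ ≤ r * m := by nlinarith
  have hs : 0 < m / k := by positivity
  -- Indeed `‖f(x)‖ ≤ r m / 0.99` and `r k < 1 / 4`.
  have hsmall : ‖evalSys f x‖ < m / k := by
    rw [lt_div_iff₀ hk0]
    nlinarith
  -- The factor `3 / 4` yields distance at most `4 / (3 * 0.99) * r k`, below `3 / 2 * r k`.
  obtain ⟨z, hz, hzx⟩ := exists_mem_zeroSet (f := f) hd hxs (c := 3 / 4 * (m / k)) (s := m / k)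
    (by positivity) (by linarith) fun y hy hyx => by
      obtain ⟨-, hmax⟩ := sqrt_mul_supNorm_le_globalK_mul_max hK hy
      rw [← hk, ← hm, mul_comm, ← div_le_iff₀ hk0] at hmax
      rcases le_max_iff.1 hmax with h | h
      · linarith
      · exact h
  refine ⟨z, hz, ?_⟩
  rw [norm_sub_rev] at hzx
  have h1 : 3 / 4 * ‖x - z‖ * m ≤ ‖evalSys f x‖ * k := by
    have : 3 / 4 * (m / k) * ‖x - z‖ * k ≤ ‖evalSys f x‖ * k := by gcongr
    calc 3 / 4 * ‖x - z‖ * m = 3 / 4 * (m / k) * ‖x - z‖ * k := by field_simp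
      _ ≤ _ := this
  have h2 : 0.99 * (3 / 4 * ‖x - z‖) * m ≤ r * k * m := by nlinarith
  have h3 := le_of_mul_le_mul_right h2 hm0
  have h4 : 3 / 2 * maxDegree d * k * δ = 3 / 2 * (r * k) := by rw [hr]; ring
  rw [h4]
  have : 0 < r * k := mul_pos hr0 hk0
  linarith

end GridK

theorem theorem4p10 (n q : ℕ) (hn : 1 ≤ n) (hq : 1 ≤ q) (d : Fin q → ℕ) (hd : ∀ i, 1 ≤ d i)
    (f : GridK.PolySystem n q) (hf : GridK.IsHomSystem d f)
    (δ : ℝ) (G : Finset (GridK.Euc (n + 1))) (hG : GridK.IsNet δ G)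
    (hδ : 4 * (GridK.maxDegree d : ℝ≥0∞) ^ 2 * GridK.globalK d f ^ 2 * ENNReal.ofReal δ < 1)
    (Q : ℝ) (hQ₁ : 0.99 * Q ≤ GridK.supNorm f) (hQ₂ : GridK.supNorm f ≤ Q) :
    Metric.hausdorffEDist (GridK.selected d f G Q δ) (GridK.zeroSet f) <
      2 * (GridK.maxDegree d : ℝ≥0∞) * GridK.globalK d f * ENNReal.ofReal δ := by
  open GridK in
  -- Some point of the nonempty sphere has an angle below `δ` to the net. Positivity excludes `⊤ * 0
  -- = 0` when `K(f) = ⊤` is ruled out.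
  have hδ0 : 0 < δ := by
    obtain ⟨x, hx⟩ := sphere_nonempty n
    obtain ⟨y, -, hy⟩ := hG.2 x hx
    exact (InnerProductGeometry.angle_nonneg x y).trans_lt hy
  have hD : 1 ≤ maxDegree d := (hd ⟨0, hq⟩).trans (le_maxDegree d _)
  have hD1 : (1 : ℝ) ≤ maxDegree d := by exact_mod_cast hD
  have hK : globalK d f ≠ ⊤ := by
    intro h
    have h1 : (4 * (maxDegree d : ℝ≥0∞) ^ 2) ≠ 0 := by
      have : (maxDegree d : ℝ≥0∞) ≠ 0 := by exact_mod_cast (by omega : maxDegree d ≠ 0)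
      simp [this]
    rw [h, ENNReal.top_pow two_ne_zero, ENNReal.mul_top h1,
      ENNReal.top_mul (ENNReal.ofReal_pos.2 hδ0).ne'] at hδ
    exact absurd hδ (by simp)
  obtain ⟨k, hk⟩ : ∃ k, k = (globalK d f).toReal := ⟨_, rfl⟩
  have hk1 : 1 ≤ k := by
    rw [hk]
    simpa using ENNReal.toReal_mono hK (one_le_globalK hf hd hq)
  have hkK : globalK d f = ENNReal.ofReal k := by rw [hk, ENNReal.ofReal_toReal hK]
  have hDE : (maxDegree d : ℝ≥0∞) = ENNReal.ofReal (maxDegree d) := by simp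
  have hDk : 1 ≤ maxDegree d * k := one_le_mul_of_one_le_of_one_le hD1 hk1
  -- Since `D K ≥ 1`, the squared hypothesis implies this linear one.
  have hKδ : 4 * (maxDegree d * k * δ) < 1 := by
    have e : 4 * (maxDegree d : ℝ≥0∞) ^ 2 * globalK d f ^ 2 * ENNReal.ofReal δ =
        ENNReal.ofReal (4 * (maxDegree d : ℝ) ^ 2 * k ^ 2 * δ) := by
      rw [hkK, hDE, ENNReal.ofReal_mul (by positivity), ENNReal.ofReal_mul (by positivity),
        ENNReal.ofReal_mul (by positivity), ENNReal.ofReal_pow (by positivity),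
        ENNReal.ofReal_pow (by positivity)]
      simp
    rw [e, ENNReal.ofReal_lt_one] at hδ
    have : 0 < maxDegree d * k * δ := by positivity
    nlinarith
  have e : 2 * (maxDegree d : ℝ≥0∞) * globalK d f * ENNReal.ofReal δ =
      ENNReal.ofReal (2 * maxDegree d * k * δ) := by
    rw [hkK, hDE, ENNReal.ofReal_mul (by positivity), ENNReal.ofReal_mul (by positivity),
      ENNReal.ofReal_mul (by positivity)]
    simp
  have hM := supNorm_pos hf hd hq hK
  have hpos : 0 < maxDegree d * k * δ := by positivity
  have hedist : ∀ {x y : Euc (n + 1)} {r s : ℝ}, ‖x - y‖ ≤ r → r ≤ s →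
      edist x y ≤ ENNReal.ofReal s := fun h h' => by
    rw [edist_dist, dist_eq_norm]
    exact ENNReal.ofReal_le_ofReal (h.trans h')
  rw [e]
  -- Pointwise estimates bound the suprema only weakly; the gap between `3 / 2` and `2` gives
  -- strictness.
  refine lt_of_le_of_lt (b := ENNReal.ofReal (3 / 2 * maxDegree d * k * δ)) ?_ ?_
  · refine Metric.hausdorffEDist_le_of_mem_edist (fun x hx => ?_) fun z hz => ?_
    · obtain ⟨z, hz, hxz⟩ :=
        exists_mem_zeroSet_of_mem_selected hf hd hq hK hG (hk ▸ hKδ) hQ₁ hQ₂ hx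
      exact ⟨z, hz, hedist hxz (by rw [hk])⟩
    · obtain ⟨x, hx, hxz⟩ := exists_mem_selected hf hd hq hG hM hQ₂ hz
      exact ⟨x, hx, hedist hxz (by nlinarith)⟩
  · rw [ENNReal.ofReal_lt_ofReal_iff (by positivity)]
    linarith
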